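/- **Theorem 8.10 (Abstract Kolmogorov extension theorem).** *Conventions.* A *σ-algebra* is a Boolean algebra in which every countable family has a join and a meet; a *morphism* of σ-algebras is a Boolean homomorphism preserving countable joins and meets. The category $\mathbf{AbsMes}$ of abstract measurable spaces is the opposite of the category of σ-algebras; we write $\Sigma_X$ for the σ-algebra of $X$ and, for $f\colon X\to Y$, $f^*\colon \Sigma_Y\to\Sigma_X$ for the corresponding morphism. A *probability measure* on $X$ is a function $\mu\colon\Sigma_X\to[0,1]$ with $\mu(0)=0$, $\mu(1)=1$ and $\mu(\bigvee_n E_n)=\sum_n\mu(E_n)$ for every sequence of pairwise disjoint $E_n\in\Sigma_X$; its pushforward under $f\colon X\to Y$ is $f_*\mu:=\mu\circ f^*$. *Products.* For an abstract measurable space $X$, let $\mathrm{St}(X)$ be the space of Boolean homomorphisms $\Sigma_X\to\{0,1\}$ with the topology induced from $\{0,1\}^{\Sigma_X}$, equipped with its Baire σ-algebra (generated by the continuous functions $\mathrm{St}(X)\to\mathbb C$). The product in $\mathbf{AbsMes}$ of a family $(X_\alpha)_{\alpha\in B}$ is $X_B=\prod_{\alpha\in B}X_\alpha$ with $$\Sigma_{X_B}:=\Big(\bigotimes_{\alpha\in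 B}\mathrm{Baire}(\mathrm{St}(X_\alpha))\Big)\Big/\mathcal N_B ,$$ where $\bigotimes$ is the product σ-algebra on $\prod_{\alpha\in B}\mathrm{St}(X_\alpha)$ and $\mathcal N_B$ is the σ-ideal generated by all preimages $\pi_\beta^{-1}(N)$, $\beta\in B$, of meager Baire sets $N\subseteq\mathrm{St}(X_\beta)$ under the coordinate maps $\pi_\beta$. For $B\subseteq B'$ the canonical projection $\pi_{X_{B'}\to X_B}\colon X_{B'}\to X_B$ is the one induced by the restriction map $\prod_{\alpha\in B'}\mathrm{St}(X_\alpha)\to\prod_{\alpha\in B}\mathrm{St}(X_\alpha)$, i.e. $\pi_{X_{B'}\to X_B}^*$ sends the class of $E$ to the class of the preimage of $E$. *Theorem.* Let $(X_\alpha)_{\alpha\in A}$ be a family of abstract measurable spaces indexed by an arbitrary (possibly uncountable) set $A$. Suppose that for each finite $F\subseteq A$ one is given a probability measure $\mu_F$ on $X_F$, and that $(\pi_{X_{F'}\to X_F})_*\mu_{F'}=\mu_F$ whenever $F\subseteq F'\subseteq A$ are finite. Then there is a unique probability measure $\mu_A$ on $X_A$ such that $(\pi_{X_A\to X_F})_*\mu_A=\mu_F$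 for all finite $F\subseteq A$. -/

import Mathlib

noncomputable section

/-! ## Abstract σ-algebras and their morphisms -/

/-- A Boolean algebra is σ-complete if every countable family has a join and a meet. -/
class SigmaComplete (B : Type*) [BooleanAlgebra B] : Prop where
  exists_isLUB : ∀ E : ℕ → B, ∃ a, IsLUB (Set.range E) a
  exists_isGLB : ∀ E : ℕ → B, ∃ a, IsGLB (Set.range E) a

/-- Morphisms of σ-complete Boolean algebras: Boolean homomorphisms that preserve countable joins
and countable meets. A morphism `Y ⟶ X` of abstract measurable spaces is by definition a
`SigmaHom X Y` of the underlying algebras (the opposite category). -/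
structure SigmaHom (A B : Type*) [BooleanAlgebra A] [BooleanAlgebra B] extends
    BoundedLatticeHom A B where
  map_isLUB' : ∀ (E : ℕ → A) (a : A), IsLUB (Set.range E) a →
    IsLUB (Set.range fun n => toFun (E n)) (toFun a)
  map_isGLB' : ∀ (E : ℕ → A) (a : A), IsGLB (Set.range E) a →
    IsGLB (Set.range fun n => toFun (E n)) (toFun a)

instance (A B : Type*) [BooleanAlgebra A] [BooleanAlgebra B] :
    CoeFun (SigmaHom A B) fun _ => A → B := ⟨fun φ => φ.toFun⟩

theorem isLUB_compl_of_isGLB {B : Type*} [BooleanAlgebra B] {E : ℕ → B} {a : B}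
    (h : IsGLB (Set.range E) a) : IsLUB (Set.range fun n => (E n)ᶜ) aᶜ := by
  refine ⟨?_, fun b hb => ?_⟩
  · rintro _ ⟨n, rfl⟩
    exact compl_le_compl (h.1 ⟨n, rfl⟩)
  · refine compl_le_of_compl_le (h.2 ?_)
    rintro _ ⟨n, rfl⟩
    exact compl_le_of_compl_le (hb ⟨n, rfl⟩)

theorem isGLB_compl_of_isLUB {B : Type*} [BooleanAlgebra B] {E : ℕ → B} {a : B}
    (h : IsLUB (Set.range E) a) : IsGLB (Set.range fun n => (E n)ᶜ) aᶜ := by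
  refine ⟨?_, fun b hb => ?_⟩
  · rintro _ ⟨n, rfl⟩
    exact compl_le_compl (h.1 ⟨n, rfl⟩)
  · refine le_compl_comm.1 (h.2 ?_)
    rintro _ ⟨n, rfl⟩
    exact le_compl_comm.1 (hb ⟨n, rfl⟩)

theorem SigmaComplete.of_isLUB {B : Type*} [BooleanAlgebra B]
    (h : ∀ E : ℕ → B, ∃ a, IsLUB (Set.range E) a) : SigmaComplete B where
  exists_isLUB := h
  exists_isGLB E := by
    obtain ⟨a, ha⟩ := h fun n => (E n)ᶜ
    exact ⟨aᶜ, by simpa using isGLB_compl_of_isLUB ha⟩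

/-- Preservation of countable joins implies that of countable meets, by complementation. -/
def SigmaHom.ofIsLUB {A B : Type*} [BooleanAlgebra A] [BooleanAlgebra B]
    (f : BoundedLatticeHom A B)
    (hf : ∀ (E : ℕ → A) (a : A), IsLUB (Set.range E) a →
      IsLUB (Set.range fun n => f (E n)) (f a)) : SigmaHom A B where
  toBoundedLatticeHom := f
  map_isLUB' := hf
  map_isGLB' E a h := by
    have h1 := isGLB_compl_of_isLUB (hf _ _ (isLUB_compl_of_isGLB h))
    simp only [map_compl', compl_compl] at h1
    exact h1

/-- Composition of morphisms of σ-complete Boolean algebras. -/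
def SigmaHom.comp {A B C : Type*} [BooleanAlgebra A] [BooleanAlgebra B] [BooleanAlgebra C]
    (ψ : SigmaHom B C) (φ : SigmaHom A B) : SigmaHom A C where
  toBoundedLatticeHom := ψ.toBoundedLatticeHom.comp φ.toBoundedLatticeHom
  map_isLUB' E a h := ψ.map_isLUB' _ _ (φ.map_isLUB' E a h)
  map_isGLB' E a h := ψ.map_isGLB' _ _ (φ.map_isGLB' E a h)

/-- A (countably additive) probability measure on a σ-complete Boolean algebra. -/
@[ext]
structure AbsProbMeasure (B : Type*) [BooleanAlgebra B] where
  toFun : B → ℝ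
  mem_Icc' : ∀ a, toFun a ∈ Set.Icc (0 : ℝ) 1
  map_bot' : toFun ⊥ = 0
  map_top' : toFun ⊤ = 1
  hasSum' : ∀ (E : ℕ → B) (a : B), (∀ n m, n ≠ m → E n ⊓ E m = ⊥) → IsLUB (Set.range E) a →
    HasSum (fun n => toFun (E n)) (toFun a)

/-- The pushforward of a probability measure along the abstractly measurable map whose underlying
algebra morphism is `φ`; as a function it is `μ ∘ φ`. -/
def AbsProbMeasure.pushforward {A B : Type*} [BooleanAlgebra A] [BooleanAlgebra B]
    (φ : SigmaHom A B) (μ : AbsProbMeasure B) : AbsProbMeasure A where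
  toFun a := μ.toFun (φ a)
  mem_Icc' a := μ.mem_Icc' _
  map_bot' := by
    have : φ ⊥ = ⊥ := φ.map_bot'
    rw [this, μ.map_bot']
  map_top' := by
    have : φ ⊤ = ⊤ := φ.map_top'
    rw [this, μ.map_top']
  hasSum' E a hE ha := by
    refine μ.hasSum' (fun n => φ (E n)) _ (fun n m hnm => ?_) (φ.map_isLUB' E a ha)
    have h1 : φ (E n ⊓ E m) = φ (E n) ⊓ φ (E m) := φ.map_inf' _ _
    have h2 : φ ⊥ = ⊥ := φ.map_bot'
    rw [← h1, hE n m hnm, h2]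

/-! ## σ-ideals and quotients by them -/

/-- A σ-ideal: a downward closed subset containing `⊥` and closed under countable joins. -/
@[ext]
structure SigmaIdeal (B : Type*) [BooleanAlgebra B] where
  carrier : Set B
  bot_mem' : ⊥ ∈ carrier
  lower' : ∀ a b, a ≤ b → b ∈ carrier → a ∈ carrier
  isLUB_mem' : ∀ (E : ℕ → B) (a : B), (∀ n, E n ∈ carrier) → IsLUB (Set.range E) a → a ∈ carrier

namespace SigmaIdeal

/-- The σ-ideal generated by a set `S`: the intersection of all σ-ideals containing `S`. -/
def generate {B : Type*} [BooleanAlgebra B] (S : Set B) : SigmaIdeal B where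
  carrier := {a | ∀ I : SigmaIdeal B, S ⊆ I.carrier → a ∈ I.carrier}
  bot_mem' I _ := I.bot_mem'
  lower' a b hab hb I hI := I.lower' a b hab (hb I hI)
  isLUB_mem' E a hE ha I hI := I.isLUB_mem' E a (fun n => hE n I hI) ha

/-- The pullback of a σ-ideal along a morphism. -/
def comap {A B : Type*} [BooleanAlgebra A] [BooleanAlgebra B] (φ : SigmaHom A B)
    (J : SigmaIdeal B) : SigmaIdeal A where
  carrier := {a | φ a ∈ J.carrier}
  bot_mem' := by
    have : φ ⊥ = ⊥ := φ.map_bot'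
    simpa [this] using J.bot_mem'
  lower' a b hab hb := J.lower' _ _ (OrderHomClass.mono φ.toBoundedLatticeHom hab) hb
  isLUB_mem' E a hE ha := J.isLUB_mem' _ _ hE (φ.map_isLUB' E a ha)

section Quotient

variable {B : Type*} [BooleanAlgebra B] (I : SigmaIdeal B)

theorem sup_mem {a b : B} (ha : a ∈ I.carrier) (hb : b ∈ I.carrier) : a ⊔ b ∈ I.carrier := by
  refine I.isLUB_mem' (fun n => if n = 0 then a else b) _ (fun n => ?_) ⟨?_, fun c hc => ?_⟩
  · split_ifs
    exacts [ha, hb]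
  · rintro _ ⟨n, rfl⟩
    beta_reduce
    split_ifs
    exacts [le_sup_left, le_sup_right]
  · exact sup_le (by simpa using hc ⟨0, rfl⟩) (by simpa using hc ⟨1, rfl⟩)

theorem symmDiff_mem {a b : B} :
    symmDiff a b ∈ I.carrier ↔ a \ b ∈ I.carrier ∧ b \ a ∈ I.carrier :=
  ⟨fun h => ⟨I.lower' _ _ le_sup_left h, I.lower' _ _ le_sup_right h⟩,
    fun h => I.sup_mem h.1 h.2⟩

theorem sdiff_trans {a b c : B} (h : a \ b ∈ I.carrier) (h' : b \ c ∈ I.carrier) :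
    a \ c ∈ I.carrier :=
  I.lower' _ _ (sdiff_triangle a b c) (I.sup_mem h h')

/-- Two elements are identified modulo `I` if their symmetric difference lies in `I`. -/
def setoid : Setoid B where
  r a b := symmDiff a b ∈ I.carrier
  iseqv :=
    { refl := fun a => by simpa using I.bot_mem'
      symm := fun {a b} h => by rwa [symmDiff_comm]
      trans := fun {a b c} h h' => by
        rw [symmDiff_mem] at *
        exact ⟨I.sdiff_trans h.1 h'.1, I.sdiff_trans h'.2 h.2⟩ }

/-- The quotient algebra `B / I`. -/
def Quot : Type _ := Quotient I.setoid

/-- The quotient map `B → B / I`. -/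
def quo (a : B) : I.Quot := Quotient.mk I.setoid a

theorem quo_eq_iff {a b : B} : I.quo a = I.quo b ↔ symmDiff a b ∈ I.carrier :=
  Quotient.eq (r := I.setoid)

theorem quo_surjective : Function.Surjective I.quo := Quotient.mk_surjective

theorem quo_eq_of {a b : B} (h : a \ b ∈ I.carrier) (h' : b \ a ∈ I.carrier) : I.quo a = I.quo b :=
  I.quo_eq_iff.2 (I.symmDiff_mem.2 ⟨h, h'⟩)

theorem sup_sdiff_sup_mem {a a' b b' : B} (ha : a \ a' ∈ I.carrier) (hb : b \ b' ∈ I.carrier) :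
    (a ⊔ b) \ (a' ⊔ b') ∈ I.carrier := by
  rw [sup_sdiff]
  exact I.sup_mem (I.lower' _ _ (sdiff_le_sdiff_left le_sup_left) ha)
    (I.lower' _ _ (sdiff_le_sdiff_left le_sup_right) hb)

theorem inf_sdiff_inf_mem {a a' b b' : B} (ha : a \ a' ∈ I.carrier) (hb : b \ b' ∈ I.carrier) :
    (a ⊓ b) \ (a' ⊓ b') ∈ I.carrier := by
  rw [sdiff_inf]
  exact I.sup_mem (I.lower' _ _ (sdiff_le_sdiff_right inf_le_left) ha)
    (I.lower' _ _ (sdiff_le_sdiff_right inf_le_right) hb)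

instance : LE I.Quot where
  le := Quotient.lift₂ (s₁ := I.setoid) (s₂ := I.setoid) (fun a b => a \ b ∈ I.carrier) (by
    intro a b a' b' ha hb
    have ha := I.symmDiff_mem.1 ha
    have hb := I.symmDiff_mem.1 hb
    exact propext ⟨fun h => I.sdiff_trans ha.2 (I.sdiff_trans h hb.1),
      fun h => I.sdiff_trans ha.1 (I.sdiff_trans h hb.2)⟩)

instance : Max I.Quot where
  max := Quotient.map₂ (sa := I.setoid) (sb := I.setoid) (sc := I.setoid) (· ⊔ ·) (by
    intro a a' ha b b' hb
    have ha := I.symmDiff_mem.1 ha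
    have hb := I.symmDiff_mem.1 hb
    exact I.symmDiff_mem.2 ⟨I.sup_sdiff_sup_mem ha.1 hb.1, I.sup_sdiff_sup_mem ha.2 hb.2⟩)

instance : Min I.Quot where
  min := Quotient.map₂ (sa := I.setoid) (sb := I.setoid) (sc := I.setoid) (· ⊓ ·) (by
    intro a a' ha b b' hb
    have ha := I.symmDiff_mem.1 ha
    have hb := I.symmDiff_mem.1 hb
    exact I.symmDiff_mem.2 ⟨I.inf_sdiff_inf_mem ha.1 hb.1, I.inf_sdiff_inf_mem ha.2 hb.2⟩)

instance : Compl I.Quot where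
  compl := Quotient.map (sa := I.setoid) (sb := I.setoid) (·ᶜ) (by
    intro a a' ha
    have ha := I.symmDiff_mem.1 ha
    refine I.symmDiff_mem.2 ⟨?_, ?_⟩
    · rw [compl_sdiff_compl]
      exact ha.2
    · rw [compl_sdiff_compl]
      exact ha.1)

instance : Top I.Quot := ⟨I.quo ⊤⟩

instance : Bot I.Quot := ⟨I.quo ⊥⟩

theorem quo_le_quo {a b : B} : I.quo a ≤ I.quo b ↔ a \ b ∈ I.carrier := Iff.rfl

theorem quo_sup (a b : B) : I.quo (a ⊔ b) = I.quo a ⊔ I.quo b := rfl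

theorem quo_inf (a b : B) : I.quo (a ⊓ b) = I.quo a ⊓ I.quo b := rfl

theorem quo_compl (a : B) : I.quo aᶜ = (I.quo a)ᶜ := rfl

theorem quo_top : I.quo ⊤ = ⊤ := rfl

theorem quo_bot : I.quo ⊥ = ⊥ := rfl

theorem quo_mono {a b : B} (h : a ≤ b) : I.quo a ≤ I.quo b := by
  rw [quo_le_quo, sdiff_eq_bot_iff.2 h]
  exact I.bot_mem'

instance : BooleanAlgebra I.Quot where
  le_refl x := by
    obtain ⟨a, rfl⟩ := I.quo_surjective x
    exact I.quo_mono le_rfl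
  le_trans x y z := by
    obtain ⟨a, rfl⟩ := I.quo_surjective x
    obtain ⟨b, rfl⟩ := I.quo_surjective y
    obtain ⟨c, rfl⟩ := I.quo_surjective z
    exact I.sdiff_trans
  le_antisymm x y := by
    obtain ⟨a, rfl⟩ := I.quo_surjective x
    obtain ⟨b, rfl⟩ := I.quo_surjective y
    exact I.quo_eq_of
  sup := max
  inf := min
  le_sup_left x y := by
    obtain ⟨a, rfl⟩ := I.quo_surjective x
    obtain ⟨b, rfl⟩ := I.quo_surjective y
    exact I.quo_mono le_sup_left
  le_sup_right x y := by
    obtain ⟨a, rfl⟩ := I.quo_surjective x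
    obtain ⟨b, rfl⟩ := I.quo_surjective y
    exact I.quo_mono le_sup_right
  sup_le x y z := by
    obtain ⟨a, rfl⟩ := I.quo_surjective x
    obtain ⟨b, rfl⟩ := I.quo_surjective y
    obtain ⟨c, rfl⟩ := I.quo_surjective z
    intro h h'
    change (a ⊔ b) \ c ∈ I.carrier
    rw [sup_sdiff]
    exact I.sup_mem h h'
  inf_le_left x y := by
    obtain ⟨a, rfl⟩ := I.quo_surjective x
    obtain ⟨b, rfl⟩ := I.quo_surjective y
    exact I.quo_mono inf_le_left
  inf_le_right x y := by
    obtain ⟨a, rfl⟩ := I.quo_surjective x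
    obtain ⟨b, rfl⟩ := I.quo_surjective y
    exact I.quo_mono inf_le_right
  le_inf x y z := by
    obtain ⟨a, rfl⟩ := I.quo_surjective x
    obtain ⟨b, rfl⟩ := I.quo_surjective y
    obtain ⟨c, rfl⟩ := I.quo_surjective z
    intro h h'
    change a \ (b ⊓ c) ∈ I.carrier
    rw [sdiff_inf]
    exact I.sup_mem h h'
  le_sup_inf x y z := by
    obtain ⟨a, rfl⟩ := I.quo_surjective x
    obtain ⟨b, rfl⟩ := I.quo_surjective y
    obtain ⟨c, rfl⟩ := I.quo_surjective z
    exact I.quo_mono le_sup_inf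
  inf_compl_le_bot x := by
    obtain ⟨a, rfl⟩ := I.quo_surjective x
    exact I.quo_mono inf_compl_eq_bot.le
  top_le_sup_compl x := by
    obtain ⟨a, rfl⟩ := I.quo_surjective x
    exact I.quo_mono sup_compl_eq_top.ge
  le_top x := by
    obtain ⟨a, rfl⟩ := I.quo_surjective x
    exact I.quo_mono le_top
  bot_le x := by
    obtain ⟨a, rfl⟩ := I.quo_surjective x
    exact I.quo_mono bot_le

theorem quo_isLUB (E : ℕ → B) (a : B) (h : IsLUB (Set.range E) a) :
    IsLUB (Set.range fun n => I.quo (E n)) (I.quo a) := by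
  refine ⟨?_, fun x hx => ?_⟩
  · rintro _ ⟨n, rfl⟩
    exact I.quo_mono (h.1 ⟨n, rfl⟩)
  · obtain ⟨b, rfl⟩ := I.quo_surjective x
    refine I.isLUB_mem' (fun n => E n \ b) (a \ b) (fun n => hx ⟨n, rfl⟩) ⟨?_, fun c hc => ?_⟩
    · rintro _ ⟨n, rfl⟩
      exact sdiff_le_sdiff_right (h.1 ⟨n, rfl⟩)
    · rw [sdiff_le_iff]
      refine h.2 ?_
      rintro _ ⟨n, rfl⟩
      exact sdiff_le_iff.1 (hc ⟨n, rfl⟩)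

/-- The quotient map as a morphism of σ-algebras. -/
def quoHom : SigmaHom B I.Quot :=
  SigmaHom.ofIsLUB
    { toFun := I.quo
      map_sup' := I.quo_sup
      map_inf' := I.quo_inf
      map_top' := I.quo_top
      map_bot' := I.quo_bot }
    I.quo_isLUB

instance [SigmaComplete B] : SigmaComplete I.Quot := by
  refine SigmaComplete.of_isLUB fun E => ?_
  choose F hF using fun n => I.quo_surjective (E n)
  obtain ⟨a, ha⟩ := SigmaComplete.exists_isLUB F
  refine ⟨I.quo a, ?_⟩
  have := I.quo_isLUB F a ha
  simpa only [hF] using this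

end Quotient

/-- A morphism that maps the σ-ideal `I` into the σ-ideal `J` descends to the quotients. -/
def quotMap {A B : Type*} [BooleanAlgebra A] [SigmaComplete A] [BooleanAlgebra B]
    (φ : SigmaHom A B) (I : SigmaIdeal A) (J : SigmaIdeal B)
    (h : ∀ a ∈ I.carrier, φ a ∈ J.carrier) : SigmaHom I.Quot J.Quot :=
  SigmaHom.ofIsLUB
    { toFun := Quotient.map (sa := I.setoid) (sb := J.setoid) φ (by
        intro a b hab
        have h1 : φ.toBoundedLatticeHom (symmDiff a b) ∈ J.carrier := h _ hab
        rw [map_symmDiff'] at h1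
        exact h1)
      map_sup' := by
        intro x y
        obtain ⟨a, rfl⟩ := I.quo_surjective x
        obtain ⟨b, rfl⟩ := I.quo_surjective y
        exact congrArg J.quo (φ.map_sup' a b)
      map_inf' := by
        intro x y
        obtain ⟨a, rfl⟩ := I.quo_surjective x
        obtain ⟨b, rfl⟩ := I.quo_surjective y
        exact congrArg J.quo (φ.map_inf' a b)
      map_top' := congrArg J.quo φ.map_top'
      map_bot' := congrArg J.quo φ.map_bot' }
    (by
      intro E x hx
      choose F hF using fun n => I.quo_surjective (E n)
      obtain rfl : (fun n => I.quo (F n)) = E := funext hF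
      obtain ⟨a, ha⟩ := SigmaComplete.exists_isLUB F
      obtain rfl : I.quo a = x := (I.quo_isLUB F a ha).unique hx
      exact J.quo_isLUB _ _ (φ.map_isLUB' F a ha))

theorem quotMap_quo {A B : Type*} [BooleanAlgebra A] [SigmaComplete A] [BooleanAlgebra B]
    (φ : SigmaHom A B) (I : SigmaIdeal A) (J : SigmaIdeal B)
    (h : ∀ a ∈ I.carrier, φ a ∈ J.carrier) (a : A) :
    quotMap φ I J h (I.quo a) = J.quo (φ a) := rfl

end SigmaIdeal

/-! ## The σ-algebra of a concrete measurable space -/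

/-- The measurable sets of a measurable space, as an abstract σ-algebra. -/
abbrev MeasSets (α : Type*) [MeasurableSpace α] : Type _ := Subtype (MeasurableSet : Set α → Prop)

namespace MeasSets

theorem isLUB_iff {α : Type*} [MeasurableSpace α] {E : ℕ → MeasSets α} {a : MeasSets α} :
    IsLUB (Set.range E) a ↔ (a : Set α) = ⋃ n, (E n : Set α) := by
  have key : IsLUB (Set.range E) ⟨⋃ n, (E n : Set α), .iUnion fun n => (E n).2⟩ := by
    refine ⟨?_, fun b hb => ?_⟩
    · rintro _ ⟨n, rfl⟩
      exact Set.subset_iUnion (fun n => (E n : Set α)) n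
    · exact Set.iUnion_subset fun n => hb ⟨n, rfl⟩
  refine ⟨fun h => congrArg Subtype.val (h.unique key), fun h => ?_⟩
  obtain rfl : a = ⟨⋃ n, (E n : Set α), .iUnion fun n => (E n).2⟩ := Subtype.ext h
  exact key

instance {α : Type*} [MeasurableSpace α] : SigmaComplete (MeasSets α) :=
  SigmaComplete.of_isLUB fun E =>
    ⟨⟨⋃ n, (E n : Set α), .iUnion fun n => (E n).2⟩, isLUB_iff.2 rfl⟩

/-- The pullback `E ↦ f ⁻¹' E` along a measurable map. -/
def preimageHom {α β : Type*} [MeasurableSpace α] [MeasurableSpace β] (f : α → β)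
    (hf : Measurable f) : SigmaHom (MeasSets β) (MeasSets α) :=
  SigmaHom.ofIsLUB
    { toFun := fun E => ⟨f ⁻¹' E, hf E.2⟩
      map_sup' := fun _ _ => rfl
      map_inf' := fun _ _ => rfl
      map_top' := rfl
      map_bot' := rfl }
    (by
      intro E a h
      rw [isLUB_iff] at h ⊢
      change f ⁻¹' (a : Set β) = ⋃ n, f ⁻¹' (E n : Set β)
      rw [h, Set.preimage_iUnion])

end MeasSets

/-! ## The Loomis–Sikorski space of an abstract σ-algebra -/

/-- The Baire σ-algebra of a (compact Hausdorff) space: the σ-algebra generated by the continuous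
complex-valued functions. -/
abbrev baireSigmaAlgebra (Z : Type*) [TopologicalSpace Z] : MeasurableSpace Z :=
  ⨆ f : C(Z, ℂ), MeasurableSpace.comap f (borel ℂ)

/-- The Stone space of a Boolean algebra `B`: the space of Boolean homomorphisms `B → {0, 1}`. -/
def StoneSpace (B : Type*) [BooleanAlgebra B] : Type _ := BoundedLatticeHom B Bool

namespace StoneSpace

variable {B : Type*} [BooleanAlgebra B]

/-- The Stone space is topologized as a subspace of `{0, 1}^B`. -/
instance : TopologicalSpace (StoneSpace B) :=
  TopologicalSpace.induced (fun (x : BoundedLatticeHom B Bool) (b : B) => x b) inferInstance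

instance : MeasurableSpace (StoneSpace B) := baireSigmaAlgebra (StoneSpace B)

/-- The clopen set `{x | x b = 1}` of the Stone space. -/
def basicClopen (b : B) : Set (StoneSpace B) :=
  {x | (show BoundedLatticeHom B Bool from x) b = true}

theorem isClopen_basicClopen (b : B) : IsClopen (basicClopen b) := by
  have h : Continuous fun x : StoneSpace B => (show BoundedLatticeHom B Bool from x) b :=
    (continuous_apply b).comp continuous_induced_dom
  exact (isClopen_discrete {true}).preimage h

theorem measurableSet_basicClopen (b : B) : MeasurableSet (basicClopen b) := by
  classical
  let f : C(StoneSpace B, ℂ) :=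
    ⟨(basicClopen b).indicator 1,
      continuous_one.indicator fun a ha => by
        rw [(isClopen_basicClopen b).frontier_eq] at ha
        exact ha.elim⟩
  have h : MeasurableSpace.comap f (borel ℂ) ≤ baireSigmaAlgebra (StoneSpace B) :=
    le_iSup (fun f : C(StoneSpace B, ℂ) => MeasurableSpace.comap f (borel ℂ)) f
  refine h _ ⟨{1}, ?_, ?_⟩
  · rw [← BorelSpace.measurable_eq (α := ℂ)]
    exact measurableSet_singleton 1
  · ext x
    by_cases hx : x ∈ basicClopen b <;> simp [f, hx]

/-- The ideal of Baire-meager sets: Baire sets that are meager. -/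
def baireMeager (B : Type*) [BooleanAlgebra B] : SigmaIdeal (MeasSets (StoneSpace B)) where
  carrier := {E | IsMeagre (E : Set (StoneSpace B))}
  bot_mem' := IsMeagre.empty
  lower' _ _ hab hb := IsMeagre.mono hab hb
  isLUB_mem' E a hE ha := by
    rw [MeasSets.isLUB_iff] at ha
    change IsMeagre (a : Set (StoneSpace B))
    rw [ha]
    exact isMeagre_iUnion hE

theorem exists_basicClopen_subset {U : Set (StoneSpace B)} (hU : IsOpen U) {x : StoneSpace B}
    (hx : x ∈ U) : ∃ b : B, x ∈ basicClopen b ∧ basicClopen b ⊆ U := by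
  classical
  obtain ⟨V, hV, rfl⟩ := isOpen_induced_iff.1 hU
  obtain ⟨I, u, hu, hIV⟩ := isOpen_pi_iff.1 hV _ hx
  let x' : BoundedLatticeHom B Bool := x
  let g : B → B := fun a => if x' a = true then a else aᶜ
  refine ⟨I.inf g, ?_, fun y hy => hIV fun a ha => ?_⟩
  · change x' (I.inf g) = ⊤
    rw [map_finset_inf, Finset.inf_eq_top_iff]
    intro a _
    by_cases h : x' a = true
    · simp [g, h]
    · have h' : x' aᶜ = (x' a)ᶜ := map_compl' x' a
      simp only [Bool.not_eq_true] at h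
      simp [g, h, h']
  · let y' : BoundedLatticeHom B Bool := y
    have hy1 : y' (I.inf g) = ⊤ := hy
    rw [map_finset_inf, Finset.inf_eq_top_iff] at hy1
    have hya : y' (g a) = ⊤ := hy1 a ha
    have hxy : y' a = x' a := by
      by_cases h : x' a = true
      · simpa [g, h] using hya
      · have h' : y' aᶜ = (y' a)ᶜ := map_compl' y' a
        simp only [Bool.not_eq_true] at h
        simpa [g, h, h'] using hya
    change y' a ∈ u a
    rw [hxy]
    exact (hu a ha).2

theorem exists_mem_basicClopen {c : B} (hc : c ≠ ⊥) : ∃ x : StoneSpace B, x ∈ basicClopen c := by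
  classical
  have hd : Disjoint (Order.PFilter.principal c : Set B) (Order.Ideal.principal (⊥ : B) : Set B) := by
    rw [Set.disjoint_left]
    intro y hy hy'
    exact hc (le_bot_iff.1 (le_trans hy hy'))
  obtain ⟨J, hJ, -, hFJ⟩ := DistribLattice.prime_ideal_of_disjoint_filter_ideal hd
  have hcJ : c ∉ J := fun h => Set.disjoint_left.1 hFJ (show c ≤ c from le_rfl) h
  have htop : (⊤ : B) ∉ J := fun h => hcJ (J.lower le_top h)
  have hsup : ∀ a b, a ⊔ b ∈ J ↔ a ∈ J ∧ b ∈ J := fun a b => Order.Ideal.sup_mem_iff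
  have hinf : ∀ a b, a ⊓ b ∈ J ↔ a ∈ J ∨ b ∈ J := fun a b =>
    ⟨hJ.mem_or_mem, fun h => h.elim (J.lower inf_le_left) (J.lower inf_le_right)⟩
  let x : BoundedLatticeHom B Bool :=
    { toFun := fun b => decide (b ∉ J)
      map_sup' := fun a b => by
        by_cases ha : a ∈ J <;> by_cases hb : b ∈ J <;> simp [hsup, ha, hb]
      map_inf' := fun a b => by
        by_cases ha : a ∈ J <;> by_cases hb : b ∈ J <;> simp [hinf, ha, hb]
      map_top' := by simp [htop]
      map_bot' := by simp }
  exact ⟨x, decide_eq_true hcJ⟩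

/-- The canonical morphism from `B` to the Baire sets of its Stone space modulo Baire-meager sets,
`b ↦ [{x | x b = 1}]`. -/
def loomisHom (B : Type*) [BooleanAlgebra B] : SigmaHom B (baireMeager B).Quot :=
  SigmaHom.ofIsLUB
    { toFun := fun b => (baireMeager B).quo ⟨basicClopen b, measurableSet_basicClopen b⟩
      map_sup' := by
        intro a b
        refine congrArg (baireMeager B).quo (Subtype.ext (Set.ext fun x => ?_))
        let x' : BoundedLatticeHom B Bool := x
        change x' (a ⊔ b) = true ↔ x' a = true ∨ x' b = true
        rw [map_sup]
        exact Bool.or_eq_true _ _ ▸ Iff.rfl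
      map_inf' := by
        intro a b
        refine congrArg (baireMeager B).quo (Subtype.ext (Set.ext fun x => ?_))
        let x' : BoundedLatticeHom B Bool := x
        change x' (a ⊓ b) = true ↔ x' a = true ∧ x' b = true
        rw [map_inf]
        exact Bool.and_eq_true _ _ ▸ Iff.rfl
      map_top' := by
        refine congrArg (baireMeager B).quo (Subtype.ext (Set.ext fun x => ?_))
        exact iff_of_true (map_top (show BoundedLatticeHom B Bool from x)) trivial
      map_bot' := by
        refine congrArg (baireMeager B).quo (Subtype.ext (Set.ext fun x => ?_))
        refine iff_of_false (fun h => ?_) (fun h => h)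
        have h1 := map_bot (show BoundedLatticeHom B Bool from x)
        exact absurd (h1.symm.trans h) (by decide) }
    (by
      intro E a h
      have key := (baireMeager B).quo_isLUB
        (fun n => ⟨basicClopen (E n), measurableSet_basicClopen (E n)⟩)
        ⟨⋃ n, basicClopen (E n), .iUnion fun n => measurableSet_basicClopen (E n)⟩
        (MeasSets.isLUB_iff.2 rfl)
      have mono : ∀ {b c : B}, b ≤ c → basicClopen b ⊆ basicClopen c := by
        intro b c hbc x hx
        have h1 := OrderHomClass.mono (show BoundedLatticeHom B Bool from x) hbc
        exact top_le_iff.1 (hx.symm.le.trans h1)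
      refine (congrArg (IsLUB _) ((baireMeager B).quo_eq_of ?_ ?_)).mpr key
      · change IsMeagre (basicClopen a \ ⋃ n, basicClopen (E n))
        refine IsNowhereDense.isMeagre ?_
        have hcl : IsClosed (basicClopen a \ ⋃ n, basicClopen (E n)) :=
          (isClopen_basicClopen a).1.sdiff (isOpen_iUnion fun n => (isClopen_basicClopen _).2)
        rw [hcl.isNowhereDense_iff, Set.eq_empty_iff_forall_notMem]
        intro x hx
        obtain ⟨b, hxb, hb⟩ := exists_basicClopen_subset isOpen_interior hx
        replace hb := hb.trans interior_subset
        have hEb : ∀ n, E n ≤ bᶜ := by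
          intro n
          rw [le_compl_iff_disjoint_right, disjoint_iff]
          by_contra hne
          obtain ⟨y, hy⟩ := exists_mem_basicClopen hne
          exact (hb (mono inf_le_right hy)).2 (Set.mem_iUnion.2 ⟨n, mono inf_le_left hy⟩)
        have hab : a ≤ bᶜ := h.2 (by rintro _ ⟨n, rfl⟩; exact hEb n)
        let x' : BoundedLatticeHom B Bool := x
        have h1 : x' b = true := hxb
        have h2 : x' bᶜ = true := mono hab (hb hxb).1
        have h3 : x' bᶜ = (x' b)ᶜ := map_compl' x' b
        rw [h2, h1] at h3
        exact absurd h3 (by decide)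
      · change IsMeagre ((⋃ n, basicClopen (E n)) \ basicClopen a)
        rw [Set.sdiff_eq_empty.2 (Set.iUnion_subset fun n => mono (h.1 ⟨n, rfl⟩))]
        exact IsMeagre.empty)

end StoneSpace

/-! ## The product of abstract measurable spaces -/

section Product

variable {ι : Type*} (X : ι → Type*) [∀ i, BooleanAlgebra (X i)]

/-- The null ideal of the product of the Loomis–Sikorski spaces of the `X i`, where the Cartesian
product of the Stone spaces carries the product of the Baire σ-algebras: it is the σ-ideal generated
by the preimages of the Baire-meager sets under the coordinate maps. -/
def productNull : SigmaIdeal (MeasSets (∀ i, StoneSpace (X i))) :=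
  SigmaIdeal.generate
    {E | ∃ i, ∃ N ∈ (StoneSpace.baireMeager (X i)).carrier,
      E = MeasSets.preimageHom (fun x : ∀ i, StoneSpace (X i) => x i) (measurable_pi_apply i) N}

/-- (The σ-algebra of) the product of the abstract measurable spaces `X i`: the measurable subsets
of the product of the Loomis–Sikorski spaces modulo the null ideal. -/
def AbsMesProd : Type _ := (productNull X).Quot

instance : BooleanAlgebra (AbsMesProd X) :=
  inferInstanceAs (BooleanAlgebra (productNull X).Quot)

instance : SigmaComplete (AbsMesProd X) :=
  inferInstanceAs (SigmaComplete (productNull X).Quot)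

theorem productNull_coord (i : ι) : ∀ N ∈ (StoneSpace.baireMeager (X i)).carrier,
    MeasSets.preimageHom (fun x : ∀ i, StoneSpace (X i) => x i) (measurable_pi_apply i) N ∈
      (productNull X).carrier :=
  fun N hN _ hI => hI ⟨i, N, hN, rfl⟩

/-- The coordinate projection `∏ j, X j ⟶ X i`, given as the morphism of σ-algebras
`b ↦ [{x | x i b = 1}]` in the opposite direction. -/
def AbsMesProd.coord (i : ι) : SigmaHom (X i) (AbsMesProd X) :=
  (SigmaIdeal.quotMap (MeasSets.preimageHom _ (measurable_pi_apply i)) _ _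
    (productNull_coord X i)).comp (StoneSpace.loomisHom (X i))

theorem measurable_reindex {κ : Type*} (f : κ → ι) :
    Measurable fun (x : ∀ i, StoneSpace (X i)) (k : κ) => x (f k) :=
  measurable_pi_lambda _ fun k => measurable_pi_apply (f k)

theorem productNull_reindex {κ : Type*} (f : κ → ι) :
    ∀ E ∈ (productNull fun k => X (f k)).carrier,
      MeasSets.preimageHom _ (measurable_reindex X f) E ∈ (productNull X).carrier := by
  intro E hE
  refine hE ((productNull X).comap (MeasSets.preimageHom _ (measurable_reindex X f))) ?_
  rintro _ ⟨k, N, hN, rfl⟩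
  exact fun I hI => hI ⟨f k, N, hN, rfl⟩

/-- For a map `f : κ → ι` of index sets, the morphism of abstract measurable spaces
`∏ i, X i ⟶ ∏ k, X (f k)` induced by `x ↦ (x (f k))ₖ`, given as the morphism of σ-algebras in the
opposite direction. For injective `f` it is the canonical projection onto a subproduct. -/
def AbsMesProd.reindex {κ : Type*} (f : κ → ι) :
    SigmaHom (AbsMesProd fun k => X (f k)) (AbsMesProd X) :=
  SigmaIdeal.quotMap (MeasSets.preimageHom _ (measurable_reindex X f)) _ _
    (productNull_reindex X f)

/-- The projections between products are compatible with the coordinate projections. -/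
theorem AbsMesProd.reindex_coord {κ : Type*} (f : κ → ι) (k : κ) (b : X (f k)) :
    AbsMesProd.reindex X f (AbsMesProd.coord (fun k => X (f k)) k b) =
      AbsMesProd.coord X (f k) b := rfl

/-- The canonical projection from the full product onto the product over a finite set `F`. -/
def AbsMesProd.proj (F : Finset ι) :
    SigmaHom (AbsMesProd fun i : F => X i) (AbsMesProd X) :=
  AbsMesProd.reindex X (fun i : F => (i : ι))

/-- The canonical projection from the product over `F'` onto the product over `F ⊆ F'`. -/
def AbsMesProd.proj₂ {F F' : Finset ι} (h : F ⊆ F') :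
    SigmaHom (AbsMesProd fun i : F => X i) (AbsMesProd fun i : F' => X i) :=
  AbsMesProd.reindex (fun i : F' => X i) (fun i : F => (⟨i, h i.2⟩ : F'))

end Product

end

open Set MeasureTheory
open scoped ENNReal

/-! A probability measure on a quotient of an algebra of measurable sets by a σ-ideal is the same
thing as an ordinary probability measure vanishing on that ideal, and abstract pushforward along an
induced morphism becomes `Measure.map` (`toMeasure_pushforward`, `toMeasure_injective`,
`exists_toMeasure_eq`). The data are thus a projective family of measures on finite products of
Stone spaces, and the claim is that it has a unique projective limit that kills the null ideal of
the full product.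

Kolmogorov extension usually needs some regularity of the measures. Here compactness replaces it.
Stone spaces are compact and their Baire σ-algebras are generated by clopen sets, so the clopen
cylinders generate the product σ-algebra. A countable cover of a clopen cylinder by clopen cylinders
has a finite subcover, so finite additivity already gives countable subadditivity, and Carathéodory
extension applies (`exists_isProjectiveLimit`).

The limit vanishes on the null ideal because each generator depends on a single coordinate `i`,
where the marginal over `{i}` already vanishes. Uniqueness is that of projective limits of finite
measures. -/

/-! ### Kolmogorov extension from clopen cylinders. -/

/-- Pulling back along a coordinate commutes with generating a σ-algebra, so preimages of generators
suffice. The family `C` is left free to serve both for clopen cylinders in the full product and for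
measurable clopen sets in a finite subproduct. -/
theorem MeasurableSpace.pi_eq_generateFrom_of_clopen {ι : Type*} {α : ι → Type*}
    [∀ i, MeasurableSpace (α i)] [∀ i, TopologicalSpace (α i)]
    (h : ∀ i, ‹∀ i, MeasurableSpace (α i)› i ≤
      MeasurableSpace.generateFrom {s : Set (α i) | MeasurableSet s ∧ IsClopen s})
    {C : Set (Set (∀ i, α i))} (hC : ∀ s ∈ C, MeasurableSet s)
    (hmem : ∀ i, ∀ s : Set (α i), MeasurableSet s → IsClopen s → Function.eval i ⁻¹' s ∈ C) :
    (MeasurableSpace.pi : MeasurableSpace (∀ i, α i)) = MeasurableSpace.generateFrom C := by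
  refine le_antisymm (iSup_le fun i => ?_) (MeasurableSpace.generateFrom_le hC)
  refine (MeasurableSpace.comap_mono (h i)).trans ?_
  rw [MeasurableSpace.comap_generateFrom]
  refine MeasurableSpace.generateFrom_mono ?_
  rintro _ ⟨s, hs, rfl⟩
  exact hmem i s hs.1 hs.2

namespace MeasureTheory

/-- The restriction of an additive content to a smaller family of sets. -/
noncomputable def AddContent.restrictTo {α : Type*} {C D : Set (Set α)} (m : AddContent ℝ≥0∞ C) (h : D ⊆ C) :
    AddContent ℝ≥0∞ D where
  toFun := m
  empty' := addContent_empty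
  sUnion' _ hI hd hU := addContent_sUnion (hI.trans h) hd (h hU)

/-- A content on a ring of clopen subsets of a compact space is countably subadditive. -/
theorem AddContent.isSigmaSubadditive_of_isClopen {α : Type*} [TopologicalSpace α] [CompactSpace α]
    {C : Set (Set α)} (hC : IsSetRing C) (hclopen : ∀ s ∈ C, IsClopen s)
    (m : AddContent ℝ≥0∞ C) : m.IsSigmaSubadditive := by
  intro f hf hU
  -- The union itself belongs to `C`, so it is closed, hence compact, while the `f n` form an open
  -- cover of it.
  obtain ⟨t, ht⟩ := (hclopen _ hU).1.isCompact.elim_finite_subcover f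
    (fun n => (hclopen _ (hf n)).2) Subset.rfl
  have heq : ⋃ n, f n = ⋃ n ∈ t, f n :=
    ht.antisymm (iUnion₂_subset fun n _ => subset_iUnion f n)
  rw [heq]
  exact (addContent_biUnion_le hC fun n _ => hf n).trans (ENNReal.sum_le_tsum t)

section Kolmogorov

variable {ι : Type*} {α : ι → Type*} [∀ i, MeasurableSpace (α i)] [∀ i, TopologicalSpace (α i)]

/-- The cylinders over measurable sets that are clopen. -/
def clopenCylinders (α : ι → Type*) [∀ i, MeasurableSpace (α i)] [∀ i, TopologicalSpace (α i)] :
    Set (Set (∀ i, α i)) :=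
  {s | s ∈ measurableCylinders α ∧ IsClopen s}

theorem isSetRing_clopenCylinders : IsSetRing (clopenCylinders α) where
  empty_mem := ⟨empty_mem_measurableCylinders α, isClopen_empty⟩
  union_mem _ _ hs ht := ⟨union_mem_measurableCylinders hs.1 ht.1, hs.2.union ht.2⟩
  sdiff_mem _ _ hs ht := ⟨sdiff_mem_measurableCylinders hs.1 ht.1, hs.2.diff ht.2⟩

theorem isPiSystem_measurable_isClopen {β : Type*} [MeasurableSpace β] [TopologicalSpace β] :
    IsPiSystem {s : Set β | MeasurableSet s ∧ IsClopen s} :=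
  fun _ hs _ ht _ => ⟨hs.1.inter ht.1, hs.2.inter ht.2⟩

/-- **Kolmogorov extension theorem** for compact spaces whose σ-algebras are generated by their
measurable clopen sets. -/
theorem IsProjectiveMeasureFamily.exists_isProjectiveLimit [∀ i, CompactSpace (α i)]
    (h : ∀ i, ‹∀ i, MeasurableSpace (α i)› i ≤
      MeasurableSpace.generateFrom {s : Set (α i) | MeasurableSet s ∧ IsClopen s})
    {P : ∀ J : Finset ι, Measure (∀ j : J, α j)} [∀ J, IsFiniteMeasure (P J)]
    (hP : IsProjectiveMeasureFamily P) : ∃ ν : Measure (∀ i, α i), IsProjectiveLimit ν P := by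
  have hgen : (MeasurableSpace.pi : MeasurableSpace (∀ i, α i)) =
      MeasurableSpace.generateFrom (clopenCylinders α) := by
    refine MeasurableSpace.pi_eq_generateFrom_of_clopen h
      (fun s hs => .of_mem_measurableCylinders hs.1) fun i s hs hs' =>
        ⟨?_, hs'.preimage (continuous_apply i)⟩
    exact (mem_measurableCylinders _).2
      ⟨{i}, (fun x => x ⟨i, Finset.mem_singleton_self i⟩) ⁻¹' s, measurable_pi_apply _ hs, rfl⟩
  -- The content is defined on all measurable cylinders, but the compactness argument works only for
  -- the clopen ones, which still generate.
  let m : AddContent ℝ≥0∞ (clopenCylinders α) :=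
    (projectiveFamilyContent hP).restrictTo fun _ hs => hs.1
  have hm : m.IsSigmaSubadditive :=
    m.isSigmaSubadditive_of_isClopen isSetRing_clopenCylinders fun _ hs => hs.2
  let ν := m.measure isSetRing_clopenCylinders.isSetSemiring hgen.le hm
  have hν (J : Finset ι) (S : Set (∀ j : J, α j)) (hS : MeasurableSet S) (hS' : IsClopen S) :
      ν (cylinder J S) = P J S :=
    (m.measure_eq _ hgen hm ⟨cylinder_mem_measurableCylinders J S hS,
      hS'.preimage (Pi.continuous_domRestrict _)⟩).trans (projectiveFamilyContent_cylinder hP hS)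
  refine ⟨ν, fun J => Eq.symm ?_⟩
  -- So far `ν` is known only on cylinders with clopen base. These bases form a generating π-system
  -- in the finite subproduct, which determines the marginal.
  refine ext_of_generate_finite {S : Set (∀ j : J, α j) | MeasurableSet S ∧ IsClopen S}
    (MeasurableSpace.pi_eq_generateFrom_of_clopen (fun j : J => h j)
      (C := {S : Set (∀ j : J, α j) | MeasurableSet S ∧ IsClopen S}) (fun _ hs => hs.1) fun j s hs hs' => ⟨measurable_pi_apply j hs, hs'.preimage (continuous_apply j)⟩)
    isPiSystem_measurable_isClopen (fun S hS => ?_) ?_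
  · rw [Measure.map_apply (Finset.measurable_restrict J) hS.1]
    exact (hν J S hS.1 hS.2).symm
  · rw [Measure.map_apply (Finset.measurable_restrict J) .univ]
    exact (hν J univ .univ isClopen_univ).symm

end Kolmogorov

end MeasureTheory

/-! ### Compactness and clopen generation for Stone spaces. -/

namespace StoneSpace

variable {B : Type*} [BooleanAlgebra B]

/-- Being a Boolean homomorphism is a conjunction of equations between finitely many coordinates, so
the Stone space is a closed subset of the compact cube `B → Bool`. -/
instance : CompactSpace (StoneSpace B) := by
  let e : StoneSpace B → B → Bool := fun x b => (show BoundedLatticeHom B Bool from x) b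
  have he : Topology.IsInducing e := ⟨rfl⟩
  have hrange : range e = {g | g ⊤ = ⊤ ∧ g ⊥ = ⊥ ∧ (∀ a b, g (a ⊔ b) = g a ⊔ g b) ∧
      ∀ a b, g (a ⊓ b) = g a ⊓ g b} := by
    ext g
    constructor
    · rintro ⟨x, rfl⟩
      let x' : BoundedLatticeHom B Bool := x
      exact ⟨map_top x', map_bot x', map_sup x', map_inf x'⟩
    · rintro ⟨h1, h2, h3, h4⟩
      let x : BoundedLatticeHom B Bool :=
        { toFun := g, map_sup' := h3, map_inf' := h4, map_top' := h1, map_bot' := h2 }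
      exact ⟨x, rfl⟩
  have hcont (op : Bool → Bool → Bool) (a b : B) :
      Continuous fun g : B → Bool => op (g a) (g b) :=
    Continuous.comp (g := fun p : Bool × Bool => op p.1 p.2)
      (f := fun g : B → Bool => (g a, g b)) continuous_of_discreteTopology (by fun_prop)
  have hclosed : IsClosed (range e) := by
    rw [hrange]
    simp only [ofPred_and, ofPred_forall]
    refine (isClosed_eq (by fun_prop) (by fun_prop)).inter
      ((isClosed_eq (by fun_prop) (by fun_prop)).inter (.inter ?_ ?_))
    · exact isClosed_iInter fun a => isClosed_iInter fun b =>
        isClosed_eq (continuous_apply _) (hcont (· ⊔ ·) a b)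
    · exact isClosed_iInter fun a => isClosed_iInter fun b =>
        isClosed_eq (continuous_apply _) (hcont (· ⊓ ·) a b)
  rw [← isCompact_univ_iff, he.isCompact_iff, image_univ]
  exact hclosed.isCompact

/-- Basic clopen sets form a base and `K` is compact, so finitely many of them inside `U` cover `K`.
A finite union of them is Baire measurable. -/
theorem exists_isClopen_between {K U : Set (StoneSpace B)} (hK : IsClosed K) (hU : IsOpen U)
    (hKU : K ⊆ U) :
    ∃ V, MeasurableSet V ∧ IsClopen V ∧ K ⊆ V ∧ V ⊆ U := by
  choose! b hxb hbU using fun (x : StoneSpace B) (hx : x ∈ U) => exists_basicClopen_subset hU hx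
  obtain ⟨t, htK, ht⟩ := hK.isCompact.elim_nhds_subcover (fun x => basicClopen (b x))
    fun x hx => (isClopen_basicClopen _).2.mem_nhds (hxb x (hKU hx))
  exact ⟨⋃ x ∈ t, basicClopen (b x), t.measurableSet_biUnion fun x _ => measurableSet_basicClopen _,
    t.finite_toSet.isClopen_biUnion fun x _ => isClopen_basicClopen _, ht,
    iUnion₂_subset fun x hx => hbU x (hKU (htK x hx))⟩

/-- The Baire σ-algebra of a Stone space is generated by clopen sets. -/
theorem baireSigmaAlgebra_le_generateFrom_isClopen :
    baireSigmaAlgebra (StoneSpace B) ≤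
      MeasurableSpace.generateFrom {s : Set (StoneSpace B) | MeasurableSet s ∧ IsClopen s} := by
  refine iSup_le fun f => ?_
  rw [borel, MeasurableSpace.comap_generateFrom]
  refine MeasurableSpace.generateFrom_le ?_
  rintro _ ⟨U, hU, rfl⟩
  replace hU : IsOpen U := hU
  -- An open subset of `ℂ` is an `F_σ`. Interpolating a clopen set between the preimage of each
  -- closed piece and that of `U` writes `f ⁻¹' U` as a countable union of clopen sets.
  obtain ⟨F, hF, hFU, hUnion, -⟩ := IsOpen.exists_iUnion_isClosed hU
  choose V hVm hV hFV hVU using fun n => exists_isClopen_between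
    ((hF n).preimage f.continuous) (hU.preimage f.continuous) (preimage_mono (hFU n))
  have heq : f ⁻¹' U = ⋃ n, V n := by
    refine Subset.antisymm ?_ (iUnion_subset hVU)
    rw [← hUnion, preimage_iUnion]
    exact iUnion_mono hFV
  rw [heq]
  exact .iUnion fun n => MeasurableSpace.measurableSet_generateFrom ⟨hVm n, hV n⟩

end StoneSpace

/-! ### Abstract measures on a quotient as ordinary measures. -/

namespace AbsProbMeasure

variable {α : Type*} [MeasurableSpace α] {I : SigmaIdeal (MeasSets α)}

/-- The measure on `α` induced by a probability measure on a quotient of its algebra of measurable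
sets. -/
noncomputable def toMeasure (μ : AbsProbMeasure I.Quot) : Measure α :=
  Measure.ofMeasurable (fun s hs => ENNReal.ofReal (μ.toFun (I.quo ⟨s, hs⟩)))
    (by
      have h : μ.toFun (I.quo ⟨∅, .empty⟩) = 0 := μ.map_bot'
      rw [h, ENNReal.ofReal_zero])
    (by
      intro f hf hd
      have h := μ.hasSum' (fun n => I.quo ⟨f n, hf n⟩) _ (fun n m hnm => ?_)
        (I.quo_isLUB (fun n => ⟨f n, hf n⟩) ⟨⋃ n, f n, .iUnion hf⟩ (MeasSets.isLUB_iff.2 rfl))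
      · rw [← h.tsum_eq, ENNReal.ofReal_tsum_of_nonneg (fun n => (μ.mem_Icc' _).1) h.summable]
      · exact congrArg I.quo (Subtype.ext (disjoint_iff_inter_eq_empty.1 (hd hnm))))

theorem toMeasure_apply (μ : AbsProbMeasure I.Quot) (E : MeasSets α) :
    μ.toMeasure E = ENNReal.ofReal (μ.toFun (I.quo E)) :=
  Measure.ofMeasurable_apply (E : Set α) E.2

instance isProbabilityMeasure_toMeasure (μ : AbsProbMeasure I.Quot) : IsProbabilityMeasure μ.toMeasure := by
  refine ⟨(μ.toMeasure_apply ⊤).trans ?_⟩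
  rw [I.quo_top, μ.map_top', ENNReal.ofReal_one]

theorem toMeasure_eq_zero (μ : AbsProbMeasure I.Quot) {E : MeasSets α} (hE : E ∈ I.carrier) :
    μ.toMeasure E = 0 := by
  have h : I.quo E = ⊥ := I.quo_eq_of (I.lower' _ _ sdiff_le hE)
    (I.lower' _ _ (sdiff_le.trans bot_le) hE)
  rw [toMeasure_apply, h, μ.map_bot', ENNReal.ofReal_zero]

theorem toMeasure_injective :
    Function.Injective (toMeasure : AbsProbMeasure I.Quot → Measure α) := by
  intro μ ν h
  refine AbsProbMeasure.ext (funext fun x => ?_)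
  obtain ⟨E, rfl⟩ := I.quo_surjective x
  have h' := congrArg (fun ρ : Measure α => ρ E) h
  simp only [toMeasure_apply] at h'
  exact (ENNReal.ofReal_eq_ofReal_iff (μ.mem_Icc' _).1 (ν.mem_Icc' _).1).1 h'

/-- Both sides give a measurable `s` the `μ`-value of the class of `f ⁻¹' s`. This turns abstract
compatibility conditions into projectivity of ordinary measures. -/
theorem toMeasure_pushforward {β : Type*} [MeasurableSpace β] {J : SigmaIdeal (MeasSets β)}
    {f : β → α} (hf : Measurable f)
    (h : ∀ E ∈ I.carrier, MeasSets.preimageHom f hf E ∈ J.carrier) (μ : AbsProbMeasure J.Quot) :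
    (μ.pushforward (SigmaIdeal.quotMap (MeasSets.preimageHom f hf) I J h)).toMeasure =
      μ.toMeasure.map f := by
  refine Measure.ext fun s hs => ?_
  rw [Measure.map_apply hf hs]
  exact (toMeasure_apply _ ⟨s, hs⟩).trans (μ.toMeasure_apply ⟨f ⁻¹' s, hf hs⟩).symm

/-- Sets congruent modulo `I` differ by a `ρ`-null set, so `ρ` descends to classes. -/
theorem exists_toMeasure_eq (ρ : Measure α) [IsProbabilityMeasure ρ]
    (h : ∀ E ∈ I.carrier, ρ E = 0) : ∃ μ : AbsProbMeasure I.Quot, μ.toMeasure = ρ := by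
  have hae {E F : MeasSets α} (hEF : symmDiff E F ∈ I.carrier) : ρ.real E = ρ.real F :=
    measureReal_congr (measure_symmDiff_eq_zero_iff.1 (h _ hEF))
  let μ : AbsProbMeasure I.Quot :=
    { toFun := Quotient.lift (s := I.setoid) (fun E : MeasSets α => ρ.real (E : Set α))
        fun _ _ hEF => hae hEF
      mem_Icc' := fun x => by
        obtain ⟨E, rfl⟩ := I.quo_surjective x
        exact ⟨measureReal_nonneg, measureReal_le_one⟩
      map_bot' := measureReal_empty
      map_top' := probReal_univ
      hasSum' := fun E a hE ha => by
        choose F hF using fun n => I.quo_surjective (E n)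
        obtain rfl : (fun n => I.quo (F n)) = E := funext hF
        obtain rfl := (I.quo_isLUB F ⟨⋃ n, F n, .iUnion fun n => (F n).2⟩
          (MeasSets.isLUB_iff.2 rfl)).unique ha
        -- Disjoint classes may have overlapping representatives, but the overlaps lie in `I` and
        -- are `ρ`-null; almost everywhere disjointness is enough for countable additivity.
        have hd : Pairwise (Function.onFun (AEDisjoint ρ) fun n => (F n : Set α)) := by
          intro n m hnm
          have h1 : I.quo (F n ⊓ F m) = I.quo ⊥ := hE n m hnm
          rw [I.quo_eq_iff, symmDiff_bot] at h1
          exact h _ h1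
        change HasSum (fun n => ρ.real (F n)) (ρ.real (⋃ n, F n))
        have h2 : ρ (⋃ n, F n) = ∑' n, ρ (F n) :=
          measure_iUnion₀ hd fun n => (F n).2.nullMeasurableSet
        rw [measureReal_def, h2, ENNReal.tsum_toReal_eq fun n => measure_ne_top _ _]
        exact (ENNReal.summable_toReal (h2 ▸ measure_ne_top _ _)).hasSum }
  refine ⟨μ, Measure.ext fun s hs => ?_⟩
  exact (μ.toMeasure_apply ⟨s, hs⟩).trans (ofReal_measureReal (measure_ne_top _ _))

end AbsProbMeasure

/-! ### Vanishing on the null ideal, and the conclusion. -/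

/-- The σ-ideal of measurable null sets of a measure. -/
def SigmaIdeal.ofMeasure {α : Type*} [MeasurableSpace α] (ρ : Measure α) :
    SigmaIdeal (MeasSets α) where
  carrier := {E | ρ E = 0}
  bot_mem' := measure_empty
  lower' _ _ hab hb := measure_mono_null hab hb
  isLUB_mem' E a hE ha := by
    change ρ a = 0
    rw [MeasSets.isLUB_iff.1 ha]
    exact measure_iUnion_null hE

theorem theorem8p10 {A : Type*} (X : A → Type*) [∀ α, BooleanAlgebra (X α)]
    [∀ α, SigmaComplete (X α)]
    (μ : ∀ F : Finset A, AbsProbMeasure (AbsMesProd fun α : F => X α))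
    (hμ : ∀ (F F' : Finset A) (h : F ⊆ F'),
      (μ F').pushforward (AbsMesProd.proj₂ X h) = μ F) :
    ∃! μA : AbsProbMeasure (AbsMesProd X),
      ∀ F : Finset A, μA.pushforward (AbsMesProd.proj X F) = μ F := by
  let P (F : Finset A) : Measure (∀ α : F, StoneSpace (X α)) :=
    AbsProbMeasure.toMeasure (I := productNull fun α : F => X α) (μ F)
  have hPprob (F : Finset A) : IsProbabilityMeasure (P F) :=
    AbsProbMeasure.isProbabilityMeasure_toMeasure (I := productNull fun α : F => X α) (μ F)
  have hP : IsProjectiveMeasureFamily (α := fun α => StoneSpace (X α)) P := by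
    intro F' F h
    change AbsProbMeasure.toMeasure (I := productNull fun α : F => X α) (μ F) = _
    rw [← hμ F F' h]
    exact AbsProbMeasure.toMeasure_pushforward _
      (productNull_reindex (fun i : F' => X i) fun i : F => ⟨i, h i.2⟩) _
  -- Having the prescribed marginals is the same as being a projective limit of `P`; this serves
  -- both existence and uniqueness.
  have key (ν : AbsProbMeasure (AbsMesProd X)) :
      (∀ F : Finset A, ν.pushforward (AbsMesProd.proj X F) = μ F) ↔
        IsProjectiveLimit (AbsProbMeasure.toMeasure (I := productNull X) ν) P := by
    refine forall_congr' fun F => ?_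
    refine (AbsProbMeasure.toMeasure_injective (I := productNull fun α : F => X α)).eq_iff.symm.trans
      (Eq.congr_left ?_)
    exact AbsProbMeasure.toMeasure_pushforward _ (productNull_reindex X fun i : F => i) _
  obtain ⟨ρ, hρ⟩ := hP.exists_isProjectiveLimit
    fun _ => StoneSpace.baireSigmaAlgebra_le_generateFrom_isClopen
  have hρprob : IsProbabilityMeasure ρ := hρ.isProbabilityMeasure
  obtain ⟨ν, hν⟩ := AbsProbMeasure.exists_toMeasure_eq (I := productNull X) ρ fun E hE => by
    -- The null ideal is the least σ-ideal containing its generators, so it suffices that the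
    -- `ρ`-null sets contain these.
    refine hE (SigmaIdeal.ofMeasure ρ) ?_
    rintro _ ⟨i, N, hN, rfl⟩
    have hnull := AbsProbMeasure.toMeasure_eq_zero (I := productNull fun α : ({i} : Finset A) => X α)
      (μ {i}) (productNull_coord (fun α : ({i} : Finset A) => X α)
        ⟨i, Finset.mem_singleton_self i⟩ N hN)
    -- The generator is a cylinder over `{i}`, so `ρ` gives it the value of `P {i}` on its base,
    -- which lies in the null ideal of the one-factor product.
    exact (hρ.measure_cylinder {i} (measurable_pi_apply _ N.2)).trans hnull
  refine ⟨ν, (key ν).2 (hν ▸ hρ), fun ν' hν' => ?_⟩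
  exact AbsProbMeasure.toMeasure_injective (I := productNull X)
    (((key ν').1 hν').unique (hν ▸ hρ))
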